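/- Let $f:\mathbb{C}\to\widehat{\mathbb{C}}=\mathbb{C}\cup\{\infty\}$ be a transcendental entire or meromorphic function, i.e. $f$ is meromorphic in $\mathbb{C}$ and has an essential singularity at $\infty$. For $a\in\widehat{\mathbb{C}}$ and $r>0$ let $D_r(a)$ be the open ball with centre $a$ and radius $r$ for the spherical metric. Let $a\in\widehat{\mathbb{C}}$ be a Baker omitted value (bov) of $f$: $f(z)\ne a$ for all $z\in\mathbb{C}$, and there is $r_0>0$ such that for every $r$ with $0<r<r_0$ each connected component of the boundary (in $\mathbb{C}$) of $f^{-1}(D_r(a))$ is bounded. Then for every $r>0$: (i) $f^{-1}(D_r(a))$ is connected; (ii) if $D_r(a)\neq\widehat{\mathbb{C}}$, then $f^{-1}(D_r(a))$ is infinitely connected, i.e. its complement in $\widehat{\mathbb{C}}$ has infinitely many connected components; (iii) each connected component of $\mathbb{C}\setminus f^{-1}(D_r(a))$ is bounded. -/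

import Mathlib

open Set Filter Topology

/-- The chordal distance on the Riemann sphere `OnePoint ℂ`, i.e. the Euclidean distance in `ℝ³`
of the stereographic images on the unit sphere. -/
noncomputable def chordalDist : OnePoint ℂ → OnePoint ℂ → ℝ
  | some z, some w => 2 * ‖z - w‖ / (Real.sqrt (1 + ‖z‖ ^ 2) * Real.sqrt (1 + ‖w‖ ^ 2))
  | some z, none => 2 / Real.sqrt (1 + ‖z‖ ^ 2)
  | none, some w => 2 / Real.sqrt (1 + ‖w‖ ^ 2)
  | none, none => 0

/-- The spherical (great-circle) distance on the Riemann sphere, the one induced by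
`2 |dz| / (1 + |z|^2)`: two points of the unit sphere at chordal distance `c` are at
great-circle distance `2 arcsin (c / 2)`. Its largest value is `π`. -/
noncomputable def sphericalDist (a b : OnePoint ℂ) : ℝ :=
  2 * Real.arcsin (chordalDist a b / 2)

/-- The open ball `D_r(a)` for the spherical metric. -/
def sphericalBall (a : OnePoint ℂ) (r : ℝ) : Set (OnePoint ℂ) :=
  {b | sphericalDist a b < r}

open Classical in
/-- The map `w ↦ 1 / w` from `ℂ` to the Riemann sphere, with `1 / 0 = ∞`. -/
noncomputable def sphereInv (w : ℂ) : OnePoint ℂ :=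
  if w = 0 then OnePoint.infty else ((w⁻¹ : ℂ) : OnePoint ℂ)

/-- `f : ℂ → Ĉ` is a meromorphic function in the plane (entire functions are included): it is not
identically `∞`, and near every point either `f` or `1 / f` is a (finite) analytic function. -/
def IsMeromorphicInPlane (f : ℂ → OnePoint ℂ) : Prop :=
  (∃ z, f z ≠ OnePoint.infty) ∧
  ∀ z : ℂ,
    (∃ g : ℂ → ℂ, AnalyticAt ℂ g z ∧ ∀ᶠ w in 𝓝 z, f w = ((g w : ℂ) : OnePoint ℂ)) ∨
    (∃ g : ℂ → ℂ, AnalyticAt ℂ g z ∧ ∀ᶠ w in 𝓝 z, f w = sphereInv (g w))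

/-- `f` has an essential singularity at `∞`: it has no limit in the Riemann sphere, finite or
infinite, as `z → ∞`. -/
def HasEssentialSingularityAtInfty (f : ℂ → OnePoint ℂ) : Prop :=
  ¬ ∃ l : OnePoint ℂ, Tendsto f (cocompact ℂ) (𝓝 l)

/-- A transcendental entire or meromorphic function `f : ℂ → Ĉ`: its (only) essential singularity
is at `∞`. -/
def IsTranscendentalMeromorphic (f : ℂ → OnePoint ℂ) : Prop :=
  IsMeromorphicInPlane f ∧ HasEssentialSingularityAtInfty f

/-- Every connected component of the plane set `S` is bounded. -/
def AllComponentsBounded (S : Set ℂ) : Prop :=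
  ∀ z ∈ S, Bornology.IsBounded (connectedComponentIn S z)

/-- `a` is a Baker omitted value of `f`: it is omitted, and for all small `r` every component of
the boundary (in `ℂ`) of `f⁻¹(D_r(a))` is bounded. -/
def IsBakerOmittedValue (f : ℂ → OnePoint ℂ) (a : OnePoint ℂ) : Prop :=
  (∀ z, f z ≠ a) ∧
  ∃ r₀ : ℝ, 0 < r₀ ∧ ∀ r : ℝ, 0 < r → r < r₀ →
    AllComponentsBounded (frontier (f ⁻¹' sphericalBall a r))

/-- The complement of `U` in the Riemann sphere. -/
def sphereCompl (U : Set ℂ) : Set (OnePoint ℂ) :=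
  ((fun z : ℂ => (z : OnePoint ℂ)) '' U)ᶜ

/-- The plane set `U` is infinitely connected: its complement in the Riemann sphere has infinitely
many connected components. -/
def IsInfinitelyConnected (U : Set ℂ) : Prop :=
  {C : Set (OnePoint ℂ) |
    ∃ x ∈ sphereCompl U, C = connectedComponentIn (sphereCompl U) x}.Infinite

/-! Rotating the sphere so that `a` becomes `∞` turns `f` into a nonconstant entire `g`, and for `r
≤ π` the preimage of the ball into `{R < ‖g‖}` with `R = cot (r / 2)`. By the maximum principle
every component of a superlevel set is unbounded. By `isBounded_or_isBounded_of_frontier`, a form of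
unicoherence of the plane, bounded frontier components forbid unbounded connected sets on both
sides. At one small radius this bounds the components of `{‖g‖ ≤ R}`; larger radii give smaller
sublevel sets, hence (iii). A second component of a superlevel set would be unbounded too, which the
same dichotomy excludes, hence (i). For (ii), a bounded sublevel set at a level `R > 0` would make
`1 / g` bounded near `∞` and give `f` a limit there. The minimum principle extends unboundedness to
`R = 0`. An unbounded set with bounded components has infinitely many of them. -/

/-! ### Plane topology: splittings and separation. -/

/-- In a compact space components are intersections of clopen sets, so some clopen piece of `X ∩
closedBall 0 M` around `x` stays in the open ball. Missing the bounding circle, it is also clopen in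
`X`. -/
theorem exists_compact_closed_split_mem {X : Set ℂ} (hX : IsClosed X)
    (hb : AllComponentsBounded X) {x : ℂ} (hx : x ∈ X) :
    ∃ A B : Set ℂ, IsCompact A ∧ IsClosed B ∧ Disjoint A B ∧ A ∪ B = X ∧ x ∈ A := by
  obtain ⟨M, hM⟩ := (hb x hx).subset_ball 0
  set Y : Set ℂ := X ∩ Metric.closedBall 0 M
  have hY : IsCompact Y := (isCompact_closedBall 0 M).inter_left hX
  have : CompactSpace Y := isCompact_iff_compactSpace.1 hY
  have hxM : x ∈ Metric.ball (0 : ℂ) M := hM (mem_connectedComponentIn hx)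
  have hxY : x ∈ Y := ⟨hx, Metric.ball_subset_closedBall hxM⟩
  have hcomp : Subtype.val '' connectedComponent (⟨x, hxY⟩ : Y) ⊆ Metric.ball 0 M := by
    refine Subset.trans ?_ hM
    refine (isPreconnected_connectedComponent.image _
      continuous_subtype_val.continuousOn).subset_connectedComponentIn
        ⟨_, mem_connectedComponent, rfl⟩ ?_
    rintro _ ⟨y, -, rfl⟩
    exact y.2.1
  obtain ⟨⟨Z, hZ, hxZ⟩, hZM⟩ :
      ∃ s : {s : Set Y // IsClopen s ∧ (⟨x, hxY⟩ : Y) ∈ s},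
        (s : Set Y) ⊆ Subtype.val ⁻¹' Metric.ball (0 : ℂ) M := by
    have : Nonempty {s : Set Y // IsClopen s ∧ (⟨x, hxY⟩ : Y) ∈ s} :=
      ⟨⟨univ, isClopen_univ, mem_univ _⟩⟩
    refine exists_subset_nhds_of_compactSpace ?_ (fun s => s.2.1.1) ?_
    · rintro ⟨s, hs, hxs⟩ ⟨t, ht, hxt⟩
      exact ⟨⟨s ∩ t, hs.inter ht, hxs, hxt⟩, inter_subset_left, inter_subset_right⟩
    · rw [← connectedComponent_eq_iInter_isClopen]
      intro y hy
      exact (Metric.isOpen_ball.preimage continuous_subtype_val).mem_nhds (hcomp ⟨y, hy, rfl⟩)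
  have hB : X \ (Subtype.val '' Z) =
      Subtype.val '' Zᶜ ∪ (X ∩ (Metric.ball (0 : ℂ) M)ᶜ) := by
    ext z
    constructor
    · rintro ⟨hzX, hz⟩
      by_cases hzM : z ∈ Metric.ball (0 : ℂ) M
      · exact Or.inl ⟨⟨z, hzX, Metric.ball_subset_closedBall hzM⟩, fun h => hz ⟨_, h, rfl⟩, rfl⟩
      · exact Or.inr ⟨hzX, hzM⟩
    · rintro (⟨y, hy, rfl⟩ | ⟨hzX, hzM⟩)
      · exact ⟨y.2.1, fun ⟨w, hw, hwy⟩ => hy (Subtype.ext hwy ▸ hw)⟩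
      · exact ⟨hzX, fun ⟨w, hw, hwz⟩ => hzM (hwz ▸ hZM hw)⟩
  refine ⟨Subtype.val '' Z, X \ (Subtype.val '' Z),
    hZ.1.isCompact.image continuous_subtype_val, ?_, disjoint_sdiff_right, ?_, ⟨_, hxZ, rfl⟩⟩
  · rw [hB]
    exact (hZ.compl.1.isCompact.image continuous_subtype_val).isClosed.union
      (hX.inter Metric.isOpen_ball.isClosed_compl)
  · refine union_sdiff_cancel ?_
    rintro _ ⟨y, -, rfl⟩
    exact y.2.1

/-- A closed plane set with bounded components splits into a compact part containing a prescribed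
bounded part and a disjoint closed part. -/
theorem exists_compact_closed_split {X : Set ℂ} (hX : IsClosed X)
    (hb : AllComponentsBounded X) (n : ℝ) :
    ∃ A B : Set ℂ, IsCompact A ∧ IsClosed B ∧ Disjoint A B ∧ A ∪ B = X ∧
      X ∩ Metric.closedBall 0 n ⊆ A := by
  have key : ∃ A B : Set ℂ, IsCompact A ∧ IsClosed B ∧ Disjoint A B ∧ A ∪ B = X ∧
      X ∩ (X ∩ Metric.closedBall 0 n) ⊆ A := by
    refine ((isCompact_closedBall (0 : ℂ) n).inter_left hX).induction_on
      (p := fun s => ∃ A B : Set ℂ, IsCompact A ∧ IsClosed B ∧ Disjoint A B ∧ A ∪ B = X ∧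
        X ∩ s ⊆ A) ?_ ?_ ?_ ?_
    · exact ⟨∅, X, isCompact_empty, hX, by simp, by simp, by simp⟩
    · rintro s t hst ⟨A, B, h1, h2, h3, h4, h5⟩
      exact ⟨A, B, h1, h2, h3, h4, (inter_subset_inter_right _ hst).trans h5⟩
    · rintro s t ⟨A, B, h1, h2, h3, h4, h5⟩ ⟨A', B', h1', h2', h3', h4', h5'⟩
      refine ⟨A ∪ A', B ∩ B', h1.union h1', h2.inter h2', ?_, ?_, ?_⟩
      · rw [Set.disjoint_left] at *
        grind
      · ext z
        have := Set.ext_iff.1 h4 z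
        have := Set.ext_iff.1 h4' z
        simp only [mem_union, mem_inter_iff] at *
        tauto
      · rw [inter_union_distrib_left]
        exact union_subset_union h5 h5'
    · rintro x ⟨hx, -⟩
      obtain ⟨A, B, h1, h2, h3, h4, h5⟩ := exists_compact_closed_split_mem hX hb hx
      refine ⟨Bᶜ, mem_nhdsWithin_of_mem_nhds
        (h2.isOpen_compl.mem_nhds (Set.disjoint_left.1 h3 h5)), A, B, h1, h2, h3, h4, ?_⟩
      rintro z ⟨hz, hzB⟩
      rw [← h4] at hz
      exact hz.resolve_right hzB
  simpa [← inter_assoc] using key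

theorem IsPreconnected.eq_of_circleExp_eq_one {C : Set ℂ} (hC : IsPreconnected C) {u : ℂ → ℝ}
    (hu : ContinuousOn u C) (h : ∀ z ∈ C, Circle.exp (u z) = 1) {x y : ℂ} (hx : x ∈ C)
    (hy : y ∈ C) : u x = u y := by
  refine (Circle.isCoveringMap_exp.eqOn_of_comp_eqOn hC (g₁ := u) (g₂ := fun _ => u y) hu
    continuousOn_const (fun z hz => ?_) hy rfl) hx
  simp [h z hz, h y hy]

/-- If the components of the frontier of a plane set `P` are bounded, then an unbounded connected
subset of `closure P` and one of `Pᶜ` cannot coexist. -/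
theorem isBounded_or_isBounded_of_frontier {P C₁ C₂ : Set ℂ}
    (hP : AllComponentsBounded (frontier P)) (h₁ : IsPreconnected C₁) (h₂ : IsPreconnected C₂)
    (hC₁ : C₁ ⊆ closure P) (hC₂ : C₂ ⊆ Pᶜ) :
    Bornology.IsBounded C₁ ∨ Bornology.IsBounded C₂ := by
  by_contra! hcon
  obtain ⟨hu₁, hu₂⟩ := hcon
  have hfar : ∀ {C : Set ℂ}, ¬ Bornology.IsBounded C → ∀ M : ℝ, ∃ z ∈ C, M < ‖z‖ := by
    intro C hC M
    by_contra! h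
    exact hC (isBounded_iff_forall_norm_le.2 ⟨M, h⟩)
  obtain ⟨x₁, hx₁, -⟩ := hfar hu₁ 0
  obtain ⟨x₂, hx₂, -⟩ := hfar hu₂ 0
  obtain ⟨A, B, hA, hB, hAB, hABF, hnA⟩ :=
    exists_compact_closed_split isClosed_frontier hP (max ‖x₁‖ ‖x₂‖)
  set D : Set ℂ := Metric.closedBall 0 (max ‖x₁‖ ‖x₂‖)
  have hA' : IsCompact (A ∪ D) := hA.union (isCompact_closedBall _ _)
  obtain ⟨M₀, hM₀⟩ := isBounded_iff_forall_norm_le.1 hA'.isBounded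
  set M : ℝ := |M₀| + 1
  set E : Set ℂ := {z | M < ‖z‖}
  have hE : IsPreconnected E := by
    have : E = Complex.exp '' {w | Real.log M < w.re} := by
      have hM : 0 < M := by positivity
      ext z
      constructor
      · intro hz
        have hz0 : 0 < ‖z‖ := hM.trans hz
        exact ⟨Complex.log z, by simpa [Complex.log_re] using Real.log_lt_log hM hz,
          Complex.exp_log (norm_pos_iff.1 hz0)⟩
      · rintro ⟨w, hw, rfl⟩
        change M < _
        rw [Complex.norm_exp]
        exact (Real.log_lt_iff_lt_exp hM).1 hw
    rw [this]
    exact (convex_halfSpace_re_gt _).isPreconnected.image _ Complex.continuous_exp.continuousOn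
  have hdisj : Disjoint (A ∪ D) (B ∪ {z | M ≤ ‖z‖}) := by
    rw [Set.disjoint_left]
    rintro z hz (hzB | hzM)
    · have hzF : z ∈ frontier P := hABF ▸ Or.inr hzB
      exact Set.disjoint_left.1 hAB (hz.elim id fun h => hnA ⟨hzF, h⟩) hzB
    · have := (hM₀ z hz).trans (le_abs_self M₀)
      change |M₀| + 1 ≤ ‖z‖ at hzM
      linarith
  -- On the frontier `l` is 0 or 1, so `exp (2πi l)` on `P` and 1 off `P` glue to a continuous
  -- circle-valued map. It lifts to `θ` on the plane. Then `θ` is constant on `D`, `E` and `C₂`, so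
  -- it agrees at `x₁` and `y₁`; yet along `C₁` it changes with `2π l`, by `2π`.
  obtain ⟨l, hlA, hlB, -⟩ := exists_continuous_zero_one_of_isClosed hA'.isClosed
    (hB.union (isClosed_le continuous_const continuous_norm)) hdisj
  have hlF : ∀ z ∈ frontier P, Circle.exp (2 * Real.pi * l z) = 1 := by
    intro z hz
    rw [← hABF] at hz
    rcases hz with hz | hz
    · simp [hlA (Or.inl hz)]
    · simp [hlB (Or.inl hz)]
  classical
  let h : C(ℂ, Circle) := ⟨P.piecewise (fun z => Circle.exp (2 * Real.pi * l z)) fun _ => 1,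
    Continuous.piecewise hlF (by fun_prop) continuous_const⟩
  have hmem : ∀ z ∈ P, h z = Circle.exp (2 * Real.pi * l z) := fun z hz => by simp [h, hz]
  have hP₂ : ∀ z ∈ Pᶜ, h z = 1 := fun z (hz : z ∉ P) => by simp [h, hz]
  have hP₁ : ∀ z ∈ closure P, h z = Circle.exp (2 * Real.pi * l z) := by
    intro z hz
    by_cases hzP : z ∈ P
    · exact hmem z hzP
    · exact (hP₂ z hzP).trans (hlF z ⟨hz, fun h => hzP (interior_subset h)⟩).symm
  have hl₁ : ∀ z, Circle.exp (2 * Real.pi * l z) = 1 → h z = 1 := by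
    intro z hz
    by_cases hzP : z ∈ P
    · exact (hmem z hzP).trans hz
    · exact hP₂ z hzP
  obtain ⟨e₀, he₀⟩ := Circle.exp_surjective (h 0)
  obtain ⟨θ, ⟨-, hθ⟩, -⟩ := Circle.isCoveringMap_exp.existsUnique_continuousMap_lifts h 0 e₀ he₀
  replace hθ : ∀ z, Circle.exp (θ z) = h z := fun z => congrFun hθ z
  have hD : θ x₁ = θ x₂ := by
    refine IsPreconnected.eq_of_circleExp_eq_one (C := D) (u := θ)
      (convex_closedBall _ _).isPreconnected (by fun_prop) (fun z hz => ?_)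
      (by simp [D]) (by simp [D])
    rw [hθ, hl₁]
    simp [hlA (Or.inr hz)]
  obtain ⟨y₁, hy₁, hy₁M⟩ := hfar hu₁ M
  obtain ⟨y₂, hy₂, hy₂M⟩ := hfar hu₂ M
  have hE' : θ y₁ = θ y₂ := by
    refine IsPreconnected.eq_of_circleExp_eq_one (u := θ) hE (by fun_prop)
      (fun z hz => ?_) hy₁M hy₂M
    rw [hθ, hl₁]
    have hz' : M ≤ ‖z‖ := le_of_lt hz
    simp [hlB (Or.inr hz')]
  have h2 : θ x₂ = θ y₂ := IsPreconnected.eq_of_circleExp_eq_one (u := θ) h₂ (by fun_prop)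
    (fun z hz => (hθ z).trans (hP₂ z (hC₂ hz))) hx₂ hy₂
  have h1 : θ x₁ - 2 * Real.pi * l x₁ = θ y₁ - 2 * Real.pi * l y₁ :=
    IsPreconnected.eq_of_circleExp_eq_one (u := fun z => θ z - 2 * Real.pi * l z) h₁
      (by fun_prop) (fun z hz => by rw [Circle.exp_sub, hθ, hP₁ z (hC₁ hz), div_self'])
      hx₁ hy₁
  have e1 : l x₁ = 0 := hlA (Or.inr (by simp [D]))
  have e2 : l y₁ = 1 := hlB (Or.inr (le_of_lt hy₁M))
  rw [e1, e2] at h1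
  linarith [Real.pi_pos]

/-! ### Level sets of entire functions. -/

theorem AllComponentsBounded.mono {S T : Set ℂ} (hT : AllComponentsBounded T) (h : S ⊆ T) :
    AllComponentsBounded S :=
  fun z hz => (hT z (h hz)).subset (connectedComponentIn_mono z h)

theorem frontier_connectedComponentIn_subset_compl {U : Set ℂ} (hU : IsOpen U) (z : ℂ) :
    frontier (connectedComponentIn U z) ⊆ Uᶜ := by
  intro x hx hxU
  obtain ⟨y, hyx, hyz⟩ := mem_closure_iff.1 hx.1 _ hU.connectedComponentIn
    (mem_connectedComponentIn hxU)
  rw [hU.connectedComponentIn.frontier_eq] at hx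
  refine hx.2 ?_
  rw [connectedComponentIn_eq hyz, ← connectedComponentIn_eq hyx]
  exact mem_connectedComponentIn hxU

theorem isOpen_norm_gt {g : ℂ → ℂ} (hg : Differentiable ℂ g) (R : ℝ) :
    IsOpen {z | R < ‖g z‖} :=
  isOpen_lt continuous_const hg.continuous.norm

theorem isClosed_norm_le {g : ℂ → ℂ} (hg : Differentiable ℂ g) (R : ℝ) :
    IsClosed {z | ‖g z‖ ≤ R} :=
  isClosed_le hg.continuous.norm continuous_const

theorem not_isBounded_connectedComponentIn_norm_gt {g : ℂ → ℂ} (hg : Differentiable ℂ g) {R : ℝ}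
    {z : ℂ} (hz : R < ‖g z‖) :
    ¬ Bornology.IsBounded (connectedComponentIn {z | R < ‖g z‖} z) := by
  intro hW
  refine hz.not_ge (Complex.norm_le_of_forall_mem_frontier_norm_le hW hg.diffContOnCl
    (fun w hw => ?_) (subset_closure (mem_connectedComponentIn hz)))
  simpa using frontier_connectedComponentIn_subset_compl (isOpen_norm_gt hg R) z hw

theorem exists_norm_gt {g : ℂ → ℂ} (hg : Differentiable ℂ g) (hc : ¬ ∃ c, ∀ z, g z = c) (R : ℝ) :
    ∃ z, R < ‖g z‖ := by
  by_contra! h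
  refine hc ⟨g 0, fun z => hg.apply_eq_apply_of_bounded
    (isBounded_iff_forall_norm_le.2 ⟨R, ?_⟩) z 0⟩
  rintro _ ⟨w, rfl⟩
  exact h w

theorem allComponentsBounded_norm_le {g : ℂ → ℂ} (hg : Differentiable ℂ g)
    (hc : ¬ ∃ c, ∀ z, g z = c) {R : ℝ}
    (hb : AllComponentsBounded (frontier {z | R < ‖g z‖})) :
    AllComponentsBounded {z | ‖g z‖ ≤ R} := by
  intro z hz
  obtain ⟨x, hx⟩ := exists_norm_gt hg hc R
  refine (isBounded_or_isBounded_of_frontier hb isPreconnected_connectedComponentIn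
    isPreconnected_connectedComponentIn ((connectedComponentIn_subset _ x).trans subset_closure)
    ((connectedComponentIn_subset _ z).trans ?_)).resolve_left
      (not_isBounded_connectedComponentIn_norm_gt hg hx)
  intro w hw
  simpa using hw

/-- The separation lemma is applied with `P` a single component: its frontier lies in the sublevel
set, and any other component is an unbounded connected subset of `Pᶜ`. -/
theorem isConnected_norm_gt {g : ℂ → ℂ} (hg : Differentiable ℂ g)
    (hc : ¬ ∃ c, ∀ z, g z = c) {R : ℝ} (hb : AllComponentsBounded {z | ‖g z‖ ≤ R}) :
    IsConnected {z | R < ‖g z‖} := by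
  obtain ⟨x, hx⟩ := exists_norm_gt hg hc R
  have hx' : x ∈ {z | R < ‖g z‖} := hx
  suffices h : {z | R < ‖g z‖} ⊆ connectedComponentIn {z | R < ‖g z‖} x by
    have := isConnected_connectedComponentIn_iff.2 hx'
    rwa [h.antisymm (connectedComponentIn_subset _ x)]
  intro y hy
  by_contra hyx
  refine (isBounded_or_isBounded_of_frontier (P := connectedComponentIn {z | R < ‖g z‖} x)
    (C₂ := connectedComponentIn {z | R < ‖g z‖} y) (hb.mono ?_)
    isPreconnected_connectedComponentIn isPreconnected_connectedComponentIn subset_closure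
    ?_).elim (not_isBounded_connectedComponentIn_norm_gt hg hx)
      (not_isBounded_connectedComponentIn_norm_gt hg hy)
  · intro w hw
    simpa using frontier_connectedComponentIn_subset_compl (isOpen_norm_gt hg R) x hw
  · intro w hwy hwx
    refine hyx ?_
    rw [connectedComponentIn_eq hwx, ← connectedComponentIn_eq hwy]
    exact mem_connectedComponentIn hy

/-- Minimum principle: a sublevel set without zeros of `g` far out has no compact open pieces
there. -/
theorem isBounded_norm_le_of_isBounded {g : ℂ → ℂ} (hg : Differentiable ℂ g)
    (hc : ¬ ∃ c, ∀ z, g z = c) {R R' : ℝ} (hR : 0 ≤ R)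
    (hb : AllComponentsBounded {z | ‖g z‖ ≤ R'})
    (hK : Bornology.IsBounded {z | ‖g z‖ ≤ R}) :
    Bornology.IsBounded {z | ‖g z‖ ≤ R'} := by
  obtain ⟨M, hM⟩ := hK.subset_closedBall 0
  obtain ⟨A, B, hA, hB, hAB, hABK, hMA⟩ :=
    exists_compact_closed_split (isClosed_norm_le hg R') hb M
  suffices h : B = ∅ by
    rw [← hABK, h, union_empty]
    exact hA.isBounded
  by_contra! hne
  obtain ⟨x, hx⟩ := hne
  obtain ⟨A₂, B₂, hA₂, hB₂, hAB₂, hABK₂, hMA₂⟩ :=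
    exists_compact_closed_split (isClosed_norm_le hg R') hb ‖x‖
  have hxA₂ : x ∈ A₂ := hMA₂ ⟨hABK ▸ Or.inr hx, by simp⟩
  -- `B ∩ A₂` is compact and relatively open in the sublevel set, outside which `‖g‖ > R'`; so a
  -- minimum over it is a local minimum in the plane.
  obtain ⟨z, ⟨hzB, hzA₂⟩, hzmin⟩ := (hA₂.inter_left hB).exists_isMinOn ⟨x, hx, hxA₂⟩
    hg.continuous.norm.continuousOn
  have hzR' : z ∈ {z | ‖g z‖ ≤ R'} := hABK ▸ Or.inr hzB
  have hzR : R < ‖g z‖ := by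
    by_contra! h
    exact Set.disjoint_left.1 hAB (hMA ⟨hzR', hM h⟩) hzB
  have hmin : IsLocalMin (norm ∘ g) z := by
    have hO : (A ∪ B₂)ᶜ ∈ 𝓝 z := by
      refine (hA.isClosed.union hB₂).isOpen_compl.mem_nhds ?_
      rintro (h | h)
      · exact Set.disjoint_left.1 hAB h hzB
      · exact Set.disjoint_left.1 hAB₂ hzA₂ h
    filter_upwards [hO] with w hw
    by_cases hwK : w ∈ {z | ‖g z‖ ≤ R'}
    · refine hzmin ⟨?_, ?_⟩
      · exact (hABK ▸ hwK : w ∈ A ∪ B).resolve_left fun h => hw (Or.inl h)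
      · exact (hABK₂ ▸ hwK : w ∈ A₂ ∪ B₂).resolve_right fun h => hw (Or.inr h)
    · exact le_trans hzR' (le_of_lt (not_le.1 hwK))
  rcases Complex.eventually_eq_or_eq_zero_of_isLocalMin_norm
    (Eventually.of_forall fun w => hg w) hmin with h | h
  · refine hc ⟨g z, fun w => ?_⟩
    have hga : AnalyticOnNhd ℂ g univ := fun w _ => hg.analyticAt w
    exact congrFun (hga.eq_of_eventuallyEq (fun _ _ => analyticAt_const) h) w
  · rw [h, norm_zero] at hzR
    exact hzR.not_ge hR

theorem exists_tendsto_inv_of_isBounded {g : ℂ → ℂ} (hg : Differentiable ℂ g) {R : ℝ}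
    (hR : 0 < R) (hK : Bornology.IsBounded {z | ‖g z‖ ≤ R}) :
    (∀ᶠ z in cocompact ℂ, g z ≠ 0) ∧
      ∃ c : ℂ, Tendsto (fun z => (g z)⁻¹) (cocompact ℂ) (𝓝 c) := by
  rw [← Metric.cobounded_eq_cocompact]
  have hev : ∀ᶠ z in Bornology.cobounded ℂ, R < ‖g z‖ := by
    filter_upwards [Bornology.isBounded_def.1 hK] with z hz
    simpa using hz
  have hinv : Tendsto (fun w : ℂ => w⁻¹) (𝓝[≠] 0) (Bornology.cobounded ℂ) :=
    tendsto_inv₀_nhdsNE_zero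
  refine ⟨hev.mono fun z hz h => ?_, ?_⟩
  · rw [h, norm_zero] at hz
    exact hz.not_gt hR
  have hlim := Complex.tendsto_limUnder_of_differentiable_on_punctured_nhds_of_bounded_under
    (f := fun w => (g w⁻¹)⁻¹) (c := 0) ?_ ?_
  · refine ⟨_, (hlim.comp (tendsto_inv₀_cobounded' (α := ℂ))).congr fun z => ?_⟩
    simp
  · filter_upwards [hinv.eventually hev, self_mem_nhdsWithin] with w hw hw0
    refine ((hg _).comp w (differentiableAt_inv hw0)).inv fun h => ?_
    rw [Function.comp_apply] at h
    rw [h, norm_zero] at hw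
    exact hw.not_gt hR
  · refine ⟨R⁻¹ + ‖(g (0 : ℂ)⁻¹)⁻¹‖, eventually_map.2 ?_⟩
    filter_upwards [hinv.eventually hev] with w hw
    refine norm_sub_le_of_le ?_ le_rfl
    rw [norm_inv]
    exact inv_anti₀ hR hw.le

/-! ### Rotating the omitted value to `∞`. -/

open scoped ComplexConjugate in
/-- The rotation of the sphere moving `a` to `∞`, on the complement of `a`. -/
noncomputable def sphereRotation (a : ℂ) : OnePoint ℂ → ℂ
  | some w => (1 + conj a * w) / (w - a)
  | none => conj a

open scoped ComplexConjugate in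
theorem sphereRotation_coe (a w : ℂ) :
    sphereRotation a (w : OnePoint ℂ) = (1 + conj a * w) / (w - a) := rfl

open scoped ComplexConjugate in
theorem sphereRotation_infty (a : ℂ) : sphereRotation a OnePoint.infty = conj a := rfl

open scoped ComplexConjugate in
theorem one_add_conj_mul_self_ne_zero (a : ℂ) : 1 + conj a * a ≠ 0 := by
  rw [Complex.conj_mul']
  exact_mod_cast (by positivity : (1 + ‖a‖ ^ 2 : ℝ) ≠ 0)

theorem chordalDist_infty_coe (w : ℂ) :
    chordalDist OnePoint.infty (w : OnePoint ℂ) = 2 / Real.sqrt (1 + ‖w‖ ^ 2) := rfl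

-- The rotation is a chordal isometry, by `|w - a|² + |1 + āw|² = (1 + |a|²)(1 + |w|²)`.
open scoped ComplexConjugate in
theorem chordalDist_eq_sphereRotation (a : ℂ) {b : OnePoint ℂ} (hb : b ≠ a) :
    chordalDist a b = 2 / Real.sqrt (1 + ‖sphereRotation a b‖ ^ 2) := by
  induction b using OnePoint.rec with
  | infty =>
    rw [sphereRotation_infty, RCLike.norm_conj]
    rfl
  | coe w =>
    have hwa : w - a ≠ 0 := sub_ne_zero.2 fun h => hb (congrArg _ h)
    have hn : 0 < ‖w - a‖ := norm_pos_iff.2 hwa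
    have key : ‖w - a‖ ^ 2 + ‖1 + conj a * w‖ ^ 2 = (1 + ‖a‖ ^ 2) * (1 + ‖w‖ ^ 2) := by
      simp only [← Complex.normSq_eq_norm_sq, Complex.normSq_apply, Complex.add_re, Complex.add_im,
        Complex.sub_re, Complex.sub_im, Complex.mul_re, Complex.mul_im, Complex.conj_re,
        Complex.conj_im, Complex.one_re, Complex.one_im]
      ring
    have h1 : 1 + ‖sphereRotation a w‖ ^ 2 =
        (1 + ‖a‖ ^ 2) * (1 + ‖w‖ ^ 2) / ‖w - a‖ ^ 2 := by
      rw [sphereRotation_coe, norm_div, ← key]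
      field_simp
    change 2 * ‖a - w‖ / (Real.sqrt (1 + ‖a‖ ^ 2) * Real.sqrt (1 + ‖w‖ ^ 2)) = _
    rw [h1, Real.sqrt_div (by positivity), Real.sqrt_sq hn.le, Real.sqrt_mul (by positivity),
      norm_sub_rev, div_div_eq_mul_div]

open scoped ComplexConjugate in
theorem sphereRotation_injOn (a : ℂ) : InjOn (sphereRotation a) {(a : OnePoint ℂ)}ᶜ := by
  have ha := one_add_conj_mul_self_ne_zero a
  have hne : ∀ {w : ℂ}, (w : OnePoint ℂ) ∈ ({(a : OnePoint ℂ)}ᶜ : Set _) → w - a ≠ 0 :=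
    fun hw => sub_ne_zero.2 fun h => hw (congrArg _ h)
  have hinf : ∀ {w : ℂ}, w - a ≠ 0 → (1 + conj a * w) / (w - a) ≠ conj a := by
    intro w hw h
    rw [div_eq_iff hw] at h
    exact ha (by linear_combination h)
  intro b hb b' hb' h
  induction b using OnePoint.rec with
  | infty =>
    induction b' using OnePoint.rec with
    | infty => rfl
    | coe w' => exact absurd h.symm (hinf (hne hb'))
  | coe w =>
    induction b' using OnePoint.rec with
    | infty => exact absurd h (hinf (hne hb))
    | coe w' =>
      rw [sphereRotation_coe, sphereRotation_coe, div_eq_div_iff (hne hb) (hne hb')] at h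
      have : (w' - w) * (1 + conj a * a) = 0 := by linear_combination h
      rw [sub_eq_zero.1 ((mul_eq_zero.1 this).resolve_right ha)]

open scoped ComplexConjugate in
theorem eq_coe_of_sphereRotation (a : ℂ) {b : OnePoint ℂ} (hb : b ≠ a)
    (h0 : sphereRotation a b ≠ 0) (h1 : 1 - conj a * (sphereRotation a b)⁻¹ ≠ 0) :
    b = (((sphereRotation a b)⁻¹ + a) / (1 - conj a * (sphereRotation a b)⁻¹) : ℂ) := by
  induction b using OnePoint.rec with
  | infty =>
    rw [sphereRotation_infty] at h0 h1
    exact absurd (by rw [mul_inv_cancel₀ h0, sub_self]) h1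
  | coe w =>
    have hwa : w - a ≠ 0 := sub_ne_zero.2 fun h => hb (congrArg _ h)
    rw [sphereRotation_coe, inv_div] at h1 ⊢
    have hw : 1 + conj a * w ≠ 0 := fun h => h0 (by rw [sphereRotation_coe, h, zero_div])
    rw [OnePoint.coe_eq_coe, eq_div_iff h1]
    linear_combination -div_mul_cancel₀ (w - a) hw

open scoped ComplexConjugate in
theorem eq_sphereInv_of_sphereRotation (a : ℂ) {b : OnePoint ℂ} (hb : b ≠ a)
    (h0 : sphereRotation a b ≠ 0) (h1 : (sphereRotation a b)⁻¹ + a ≠ 0) :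
    b = sphereInv ((1 - conj a * (sphereRotation a b)⁻¹) / ((sphereRotation a b)⁻¹ + a)) := by
  by_cases h2 : 1 - conj a * (sphereRotation a b)⁻¹ = 0
  · rw [h2, zero_div, sphereInv, if_pos rfl]
    induction b using OnePoint.rec with
    | infty => rfl
    | coe w =>
      have hwa : w - a ≠ 0 := sub_ne_zero.2 fun h => hb (congrArg _ h)
      have hw : 1 + conj a * w ≠ 0 := fun h => h0 (by rw [sphereRotation_coe, h, zero_div])
      rw [sphereRotation_coe, inv_div] at h2
      field_simp at h2
      exact absurd (by linear_combination h2) (one_add_conj_mul_self_ne_zero a)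
  · rw [sphereInv, if_neg (div_ne_zero h2 h1), inv_div]
    exact eq_coe_of_sphereRotation a hb h0 h2

theorem tendsto_sphereInv_zero : Tendsto sphereInv (𝓝 0) (𝓝 OnePoint.infty) := by
  rw [← nhdsNE_sup_pure, tendsto_sup]
  constructor
  · have h : Tendsto (fun w : ℂ => ((w⁻¹ : ℂ) : OnePoint ℂ)) (𝓝[≠] 0) (𝓝 OnePoint.infty) := by
      refine OnePoint.tendsto_coe_infty.comp ?_
      rw [coclosedCompact_eq_cocompact, ← Metric.cobounded_eq_cocompact]
      exact tendsto_inv₀_nhdsNE_zero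
    refine h.congr' ?_
    filter_upwards [self_mem_nhdsWithin] with w hw
    exact (if_neg hw).symm
  · rw [tendsto_pure_left]
    intro s hs
    rw [sphereInv, if_pos rfl]
    exact mem_of_mem_nhds hs

-- With `u = 1 / g`, the inverse rotation is `(u + a) / (1 - āu)`. Numerator and denominator never
-- vanish together, so one of the two charts of the sphere applies at the limit.
open scoped ComplexConjugate in
theorem exists_tendsto_of_sphereRotation (a : ℂ) {f : ℂ → OnePoint ℂ} {l : Filter ℂ}
    (hfa : ∀ z, f z ≠ a) (h0 : ∀ᶠ z in l, sphereRotation a (f z) ≠ 0) {c : ℂ}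
    (hc : Tendsto (fun z => (sphereRotation a (f z))⁻¹) l (𝓝 c)) :
    ∃ b, Tendsto f l (𝓝 b) := by
  have hd := (hc.const_mul (conj a)).const_sub 1
  have hn := hc.add_const a
  by_cases h : 1 - conj a * c = 0
  · have hca : c + a ≠ 0 := fun h' =>
      one_add_conj_mul_self_ne_zero a (by linear_combination h + conj a * h')
    have hlim := hd.div hn hca
    rw [h, zero_div] at hlim
    refine ⟨_, (tendsto_sphereInv_zero.comp hlim).congr' ?_⟩
    filter_upwards [h0, hn.eventually_ne hca] with z hz0 hz1
    exact (eq_sphereInv_of_sphereRotation a (hfa z) hz0 hz1).symm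
  · refine ⟨_, ((OnePoint.continuous_coe.tendsto _).comp (hn.div hd h)).congr' ?_⟩
    filter_upwards [h0, hd.eventually_ne h] with z hz0 hz1
    exact (eq_coe_of_sphereRotation a (hfa z) hz0 hz1).symm

open scoped ComplexConjugate in
theorem differentiable_sphereRotation_comp (a : ℂ) {f : ℂ → OnePoint ℂ}
    (hf : IsMeromorphicInPlane f) (hfa : ∀ z, f z ≠ a) :
    Differentiable ℂ fun z => sphereRotation a (f z) := by
  intro z
  rcases hf.2 z with ⟨G, hG, hfG⟩ | ⟨G, hG, hfG⟩
  · have h : (fun w => sphereRotation a (f w)) =ᶠ[𝓝 z]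
        fun w => (1 + conj a * G w) / (G w - a) := by
      filter_upwards [hfG] with w hw
      rw [hw, sphereRotation_coe]
    rw [h.differentiableAt_iff]
    refine ((hG.differentiableAt.const_mul _).const_add _).div
      (hG.differentiableAt.sub_const _) fun h0 => hfa z ?_
    rw [hfG.self_of_nhds, sub_eq_zero.1 h0]
  · have hne : 1 - a * G z ≠ 0 := by
      intro h0
      refine hfa z ?_
      have h1 : G z ≠ 0 := fun h1 => by simp [h1] at h0
      rw [hfG.self_of_nhds, sphereInv, if_neg h1, OnePoint.coe_eq_coe]
      field_simp
      linear_combination h0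
    have h : (fun w => sphereRotation a (f w)) =ᶠ[𝓝 z]
        fun w => (G w + conj a) / (1 - a * G w) := by
      filter_upwards [hfG] with w hw
      rw [hw, sphereInv]
      split_ifs with h0
      · simp [sphereRotation_infty, h0]
      · rw [sphereRotation_coe]
        field_simp
    rw [h.differentiableAt_iff]
    exact (hG.differentiableAt.add_const _).div
      ((hG.differentiableAt.const_mul _).const_sub _) hne

theorem exists_differentiable_coe_eq {f : ℂ → OnePoint ℂ}
    (hf : IsMeromorphicInPlane f) (hfa : ∀ z, f z ≠ OnePoint.infty) :
    ∃ g : ℂ → ℂ, Differentiable ℂ g ∧ ∀ z, f z = (g z : OnePoint ℂ) := by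
  choose g hg using fun z => OnePoint.ne_infty_iff_exists.1 (hfa z)
  refine ⟨g, fun z => ?_, fun z => (hg z).symm⟩
  rcases hf.2 z with ⟨G, hG, hfG⟩ | ⟨G, hG, hfG⟩
  · have h : g =ᶠ[𝓝 z] G := by
      filter_upwards [hfG] with w hw
      rwa [← hg, OnePoint.coe_eq_coe] at hw
    exact h.differentiableAt_iff.2 hG.differentiableAt
  · have hne : ∀ w, f w = sphereInv (G w) → G w ≠ 0 := by
      intro w hw h0
      rw [sphereInv, if_pos h0] at hw
      exact hfa w hw
    have h : g =ᶠ[𝓝 z] fun w => (G w)⁻¹ := by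
      filter_upwards [hfG] with w hw
      have h0 := hne w hw
      rwa [← hg, sphereInv, if_neg h0, OnePoint.coe_eq_coe] at hw
    exact h.differentiableAt_iff.2 (hG.differentiableAt.inv (hne z hfG.self_of_nhds))

/-- A transcendental meromorphic function omitting `a` is, up to a rotation of the sphere taking
`a` to `∞`, an entire function `g` without a limit at `∞`. -/
theorem exists_entire_of_omitted {f : ℂ → OnePoint ℂ} (hf : IsTranscendentalMeromorphic f)
    {a : OnePoint ℂ} (ha : ∀ z, f z ≠ a) :
    ∃ g : ℂ → ℂ, Differentiable ℂ g ∧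
      (∀ z, chordalDist a (f z) = 2 / Real.sqrt (1 + ‖g z‖ ^ 2)) ∧
      (¬ ∃ c, ∀ z, g z = c) ∧
      ∀ R : ℝ, 0 < R → ¬ Bornology.IsBounded {z | ‖g z‖ ≤ R} := by
  induction a using OnePoint.rec with
  | infty =>
    obtain ⟨g, hg, hfg⟩ := exists_differentiable_coe_eq hf.1 ha
    refine ⟨g, hg, fun z => by rw [hfg, chordalDist_infty_coe], ?_, ?_⟩
    · rintro ⟨c, hc⟩
      exact hf.2 ⟨(c : OnePoint ℂ), tendsto_const_nhds.congr fun z => by rw [hfg, hc]⟩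
    · intro R hR hK
      obtain ⟨h0, c, hc⟩ := exists_tendsto_inv_of_isBounded hg hR hK
      refine hf.2 ?_
      by_cases hc0 : c = 0
      · rw [hc0] at hc
        refine ⟨_, (tendsto_sphereInv_zero.comp hc).congr' ?_⟩
        filter_upwards [h0] with z hz
        rw [Function.comp_apply, sphereInv, if_neg (inv_ne_zero hz), inv_inv, hfg]
      · refine ⟨_, ((OnePoint.continuous_coe.tendsto _).comp (hc.inv₀ hc0)).congr fun z => ?_⟩
        rw [Function.comp_apply, inv_inv, hfg]
  | coe a =>
    have hg := differentiable_sphereRotation_comp a hf.1 ha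
    refine ⟨_, hg, fun z => chordalDist_eq_sphereRotation a (ha z), ?_, ?_⟩
    · rintro ⟨c, hc⟩
      exact hf.2 ⟨f 0, tendsto_const_nhds.congr fun z =>
        sphereRotation_injOn a (ha 0) (ha z) ((hc 0).trans (hc z).symm)⟩
    · intro R hR hK
      obtain ⟨h0, c, hc⟩ := exists_tendsto_inv_of_isBounded hg hR hK
      exact hf.2 (exists_tendsto_of_sphereRotation a ha h0 hc)

/-! ### Spherical balls as superlevel sets. -/

/-- The radius `R` such that the spherical ball of radius `r` about `∞` is `{w | R < ‖w‖}`. -/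
noncomputable def superlevelRadius (r : ℝ) : ℝ := Real.cos (r / 2) / Real.sin (r / 2)

theorem two_mul_arcsin_lt_iff {r x : ℝ} (hr : 0 < r) (hrπ : r ≤ Real.pi) :
    2 * Real.arcsin (2 / Real.sqrt (1 + x ^ 2) / 2) < r ↔ superlevelRadius r < |x| := by
  have hs : 0 < Real.sin (r / 2) :=
    Real.sin_pos_of_pos_of_lt_pi (by linarith) (by linarith [Real.pi_pos])
  have hc : 0 ≤ Real.cos (r / 2) :=
    Real.cos_nonneg_of_neg_pi_div_two_le_of_le (by linarith [Real.pi_pos]) (by linarith)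
  have h1 : 2 * Real.arcsin (2 / Real.sqrt (1 + x ^ 2) / 2) < r ↔
      Real.arcsin (2 / Real.sqrt (1 + x ^ 2) / 2) < r / 2 := by
    constructor <;> intro h <;> linarith
  have h2 : 2 / Real.sqrt (1 + x ^ 2) / 2 = 1 / Real.sqrt (1 + x ^ 2) := by ring
  have hsq : 0 < Real.sqrt (1 + x ^ 2) := Real.sqrt_pos.2 (by positivity)
  rw [h1, h2, Real.arcsin_lt_iff_lt_sin' ⟨by linarith, by linarith⟩, div_lt_iff₀ hsq,
    superlevelRadius, div_lt_iff₀ hs, ← sq_lt_sq₀ zero_le_one (by positivity),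
    ← sq_lt_sq₀ hc (by positivity), mul_pow, mul_pow, Real.sq_sqrt (by positivity), sq_abs,
    Real.cos_sq']
  constructor <;> intro h <;> linarith

theorem superlevelRadius_nonneg {r : ℝ} (hr : 0 < r) (hrπ : r ≤ Real.pi) :
    0 ≤ superlevelRadius r :=
  div_nonneg
    (Real.cos_nonneg_of_neg_pi_div_two_le_of_le (by linarith [Real.pi_pos]) (by linarith))
    (Real.sin_nonneg_of_nonneg_of_le_pi (by linarith) (by linarith))

theorem superlevelRadius_pos {r : ℝ} (hr : 0 < r) (hrπ : r < Real.pi) :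
    0 < superlevelRadius r :=
  div_pos
    (Real.cos_pos_of_mem_Ioo ⟨by linarith, by linarith⟩)
    (Real.sin_pos_of_pos_of_lt_pi (by linarith) (by linarith))

theorem sphericalBall_eq_univ (a : OnePoint ℂ) {r : ℝ} (hr : Real.pi < r) :
    sphericalBall a r = univ := by
  refine eq_univ_of_forall fun b => ?_
  change 2 * Real.arcsin _ < r
  linarith [Real.arcsin_le_pi_div_two (chordalDist a b / 2)]

theorem sphericalBall_mono (a : OnePoint ℂ) {r s : ℝ} (h : r ≤ s) :
    sphericalBall a r ⊆ sphericalBall a s := fun _ hb => lt_of_lt_of_le hb h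

/-! ### Infinite connectivity and the conclusion. -/

/-- If the complement of `U` is closed, unbounded and has bounded components, then `U` is
infinitely connected. -/
theorem isInfinitelyConnected_of_compl {U : Set ℂ} (hU : IsOpen U)
    (hb : AllComponentsBounded Uᶜ) (hnb : ¬ Bornology.IsBounded Uᶜ) :
    IsInfinitelyConnected U := by
  intro hfin
  have hmem : ∀ z ∈ Uᶜ, (z : OnePoint ℂ) ∈ sphereCompl U := by
    rintro z hz ⟨u, hu, huz⟩
    exact hz (OnePoint.coe_injective huz ▸ hu)
  have key : ∀ z ∈ Uᶜ, Bornology.IsBounded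
      ((↑) ⁻¹' connectedComponentIn (sphereCompl U) (z : OnePoint ℂ) : Set ℂ) := by
    intro z hz
    obtain ⟨A, B, hA, hB, hAB, hABU, hzA⟩ :=
      exists_compact_closed_split_mem hU.isClosed_compl hb hz
    refine hA.isBounded.subset fun w hw => ?_
    have hz' := hmem z hz
    have hcl : IsClosed ((↑) '' A : Set (OnePoint ℂ)) :=
      (hA.image OnePoint.continuous_coe).isClosed
    -- This closed set is `B ∪ {∞}`, disjoint from `A`; a component through `z ∈ A` cannot reach it.
    have hcl' : IsClosed ((↑) '' Bᶜ : Set (OnePoint ℂ))ᶜ :=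
      (OnePoint.isOpenMap_coe _ hB.isOpen_compl).isClosed_compl
    have hsub := isPreconnected_closed_iff.1 (isPreconnected_connectedComponentIn
      (F := sphereCompl U) (x := (z : OnePoint ℂ))) _ _ hcl hcl'
    by_contra hwA
    have hcover : connectedComponentIn (sphereCompl U) (z : OnePoint ℂ) ⊆
        ((↑) '' A : Set (OnePoint ℂ)) ∪ ((↑) '' Bᶜ : Set (OnePoint ℂ))ᶜ := by
      intro b hb
      have hbU := connectedComponentIn_subset _ _ hb
      by_cases hbB : b ∈ ((↑) '' Bᶜ : Set (OnePoint ℂ))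
      · obtain ⟨u, hu, rfl⟩ := hbB
        have huU : u ∈ Uᶜ := fun h => hbU ⟨u, h, rfl⟩
        rw [← hABU] at huU
        exact Or.inl ⟨u, huU.resolve_right hu, rfl⟩
      · exact Or.inr hbB
    obtain ⟨b, -, ⟨u, hu, rfl⟩, hbB⟩ := hsub hcover
      ⟨_, mem_connectedComponentIn hz', z, hzA, rfl⟩ ⟨_, hw, by
        rintro ⟨u, hu, huw⟩
        have huU : u ∈ Uᶜ := fun h => connectedComponentIn_subset _ _ hw
          ⟨u, h, huw⟩
        rw [← hABU] at huU
        rw [OnePoint.coe_injective huw] at huU hu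
        exact huU.elim hwA hu⟩
    exact hbB ⟨u, Set.disjoint_left.1 hAB hu, rfl⟩
  refine hnb ?_
  have hfin' : ((fun z : ℂ => connectedComponentIn (sphereCompl U) (z : OnePoint ℂ)) ''
      Uᶜ).Finite := by
    refine hfin.subset ?_
    rintro _ ⟨z, hz, rfl⟩
    exact ⟨z, hmem z hz, rfl⟩
  refine ((Bornology.isBounded_biUnion hfin' (f := fun C => (↑) ⁻¹' C)).2 ?_).subset ?_
  · rintro _ ⟨z, hz, rfl⟩
    exact key z hz
  · intro z hz
    exact mem_biUnion ⟨z, hz, rfl⟩ (mem_connectedComponentIn (hmem z hz))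

theorem mainTheorem7 (f : ℂ → OnePoint ℂ) (hf : IsTranscendentalMeromorphic f)
    (a : OnePoint ℂ) (ha : IsBakerOmittedValue f a) :
    ∀ r : ℝ, 0 < r →
      IsConnected (f ⁻¹' sphericalBall a r) ∧
      (sphericalBall a r ≠ Set.univ → IsInfinitelyConnected (f ⁻¹' sphericalBall a r)) ∧
      AllComponentsBounded (f ⁻¹' sphericalBall a r)ᶜ := by
  intro r hr
  rcases lt_or_ge Real.pi r with hrπ | hrπ
  · rw [sphericalBall_eq_univ a hrπ, preimage_univ]
    exact ⟨isConnected_univ, fun h => absurd rfl h, fun z hz => absurd (mem_univ z) hz⟩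
  obtain ⟨hfa, r₀, hr₀, hbov⟩ := ha
  obtain ⟨g, hg, hchord, hconst, hnb⟩ := exists_entire_of_omitted hf hfa
  have hball : ∀ {s : ℝ}, 0 < s → s ≤ Real.pi →
      f ⁻¹' sphericalBall a s = {z | superlevelRadius s < ‖g z‖} := by
    intro s hs hsπ
    ext z
    change 2 * Real.arcsin (chordalDist a (f z) / 2) < s ↔ _
    rw [hchord, two_mul_arcsin_lt_iff hs hsπ, abs_norm]
    rfl
  have hcompl : ∀ R : ℝ, {z | R < ‖g z‖}ᶜ = {z | ‖g z‖ ≤ R} := fun R => by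
    ext z
    simp
  -- Halving gives `s < r₀`, and `s < π` even when `r = π`, so the level at `s` is positive, as the
  -- unboundedness of sublevel sets requires.
  set s : ℝ := min (r / 2) (r₀ / 2)
  have hs : 0 < s := by positivity
  have hsr : s ≤ r / 2 := min_le_left _ _
  have hsr₀ : s < r₀ := (min_le_right _ _).trans_lt (by linarith)
  have hKs : AllComponentsBounded {z | ‖g z‖ ≤ superlevelRadius s} := by
    refine allComponentsBounded_norm_le hg hconst ?_
    rw [← hball hs (by linarith)]
    exact hbov s hs hsr₀
  have hKr : AllComponentsBounded {z | ‖g z‖ ≤ superlevelRadius r} := by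
    refine hKs.mono ?_
    rw [← hcompl, ← hcompl, ← hball hr hrπ, ← hball hs (by linarith)]
    exact compl_subset_compl.2 (preimage_mono (sphericalBall_mono a (by linarith)))
  rw [hball hr hrπ]
  refine ⟨isConnected_norm_gt hg hconst hKr, fun _ => ?_, hcompl _ ▸ hKr⟩
  refine isInfinitelyConnected_of_compl (isOpen_norm_gt hg _) (hcompl _ ▸ hKr) fun hK => ?_
  rw [hcompl] at hK
  exact hnb _ (superlevelRadius_pos hs (by linarith [Real.pi_pos]))
    (isBounded_norm_le_of_isBounded hg hconst (superlevelRadius_nonneg hr hrπ) hKs hK)
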